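/- All graphs are finite and undirected, without loops, possibly with multiple edges. The Cartesian product $\Sigma\square\Theta$ has vertex set $V(\Sigma)\times V(\Theta)$ and edge set $(V(\Sigma)\times E(\Theta))\cup(E(\Sigma)\times V(\Theta))$; an edge $(u,e')$ with $u\in V(\Sigma)$, $e'\in E(\Theta)$ has the ends $(u,u')$ and $(u,v')$, where $u',v'$ are the ends of $e'$, and an edge $(e,u')$ with $e\in E(\Sigma)$, $u'\in V(\Theta)$ has the ends $(u,u')$ and $(v,u')$, where $u,v$ are the ends of $e$. Let $\mathcal K_2$ be the complete graph of order $2$. A graph $\Gamma$ is a *Cartesian graph bundle with fibre $\Theta$ over the base graph $\Sigma$* if there is a mapping $p$ that sends every vertex of $\Gamma$ to a vertex of $\Sigma$ and every edge of $\Gamma$ to an edge or a vertex of $\Sigma$, such that 1. $p$ maps adjacent vertices of $\Gamma$ to adjacent or identical vertices of $\Sigma$; 2. for every $v\in V(\Sigma)$, the vertices and edges in $p^{-1}(v)$ form a subgraph of $\Gamma$ that is isomorphic to $\Theta$; 3. for every edge $e\in E(\Sigma)$ with ends $u$ and $v$, the vertices and edges in $p^{-1}(e)\cup p^{-1}(u)\cup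 p^{-1}(v)$ form a subgraph of $\Gamma$ that is isomorphic to $\mathcal K_2\square\Theta$. A graph $\Gamma$ admits a *nowhere-zero $4$-flow* if there are an orientation of $\Gamma$ and a map $\varphi\colon E(\Gamma)\to\mathbb Z$ with $0<|\varphi(e)|<4$ for every $e\in E(\Gamma)$ such that, at every vertex $v$, the sum of $\varphi$ over the edges with tail $v$ equals the sum of $\varphi$ over the edges with head $v$. **Theorem.** Let $\Sigma$ and $\Theta$ be graphs without isolated vertices. Then every Cartesian graph bundle $\Gamma$ with fibre $\Theta$ over the base graph $\Sigma$ admits a nowhere-zero $4$-flow. -/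

import Mathlib

open scoped Graph

namespace Graph

variable {α β γ δ : Type*}

/-- The standing convention on graphs: finitely many vertices and edges and no loops; parallel
edges are allowed. -/
structure IsFiniteLoopless (G : Graph α β) : Prop where
  finite_vertexSet : V(G).Finite
  finite_edgeSet : E(G).Finite
  loopless : G.Loopless

/-- No vertex is isolated: every vertex is an end of some edge. -/
def NoIsolatedVertex (G : Graph α β) : Prop :=
  ∀ x ∈ V(G), ∃ e, G.Inc e x

/-- An isomorphism of multigraphs: bijections between the vertices and between the edges which
respect the ends of the edges. -/
structure Isom (G : Graph α β) (H : Graph γ δ) where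
  vertexEquiv : V(G) ≃ V(H)
  edgeEquiv : E(G) ≃ E(H)
  isLink_iff : ∀ (e : E(G)) (x y : V(G)),
    H.IsLink (edgeEquiv e) (vertexEquiv x) (vertexEquiv y) ↔ G.IsLink e x y

/-- The Cartesian product of two multigraphs. Its edges are the pairs `(u, e')` of a vertex of `G`
and an edge of `H`, which have the ends `(u, u')` and `(u, v')` where `u'` and `v'` are the ends of
`e'`, and the pairs `(e, u')` of an edge of `G` and a vertex of `H`, which have the ends `(u, u')`
and `(v, u')` where `u` and `v` are the ends of `e`. -/
def cartesianProduct (G : Graph α β) (H : Graph γ δ) : Graph (α × γ) ((α × δ) ⊕ (β × γ)) where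
  vertexSet := V(G) ×ˢ V(H)
  IsLink a x y := match a with
    | .inl (u, e') => u ∈ V(G) ∧ x.1 = u ∧ y.1 = u ∧ H.IsLink e' x.2 y.2
    | .inr (e, u') => u' ∈ V(H) ∧ x.2 = u' ∧ y.2 = u' ∧ G.IsLink e x.1 y.1
  isLink_symm := by
    rintro (⟨u, e'⟩ | ⟨e, u'⟩) -
    · exact ⟨fun x y h ↦ ⟨h.1, h.2.2.1, h.2.1, h.2.2.2.symm⟩⟩
    · exact ⟨fun x y h ↦ ⟨h.1, h.2.2.1, h.2.1, h.2.2.2.symm⟩⟩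
  eq_or_eq_of_isLink_of_isLink := by
    rintro (⟨u, e'⟩ | ⟨e, u'⟩) ⟨x₁, x₂⟩ ⟨y₁, y₂⟩ ⟨v₁, v₂⟩ ⟨w₁, w₂⟩ ⟨-, hx, hy, h⟩ ⟨-, hv, hw, h'⟩
    · rcases h.left_eq_or_eq h' with h'' | h'' <;> simp_all
    · rcases h.left_eq_or_eq h' with h'' | h'' <;> simp_all
  left_mem_of_isLink := by
    rintro (⟨u, e'⟩ | ⟨e, u'⟩) ⟨x₁, x₂⟩ ⟨y₁, y₂⟩ ⟨hu, hx, -, h⟩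
    · exact ⟨hx ▸ hu, h.left_mem⟩
    · exact ⟨h.left_mem, hx ▸ hu⟩

/-- The complete graph of order two. -/
def completeTwo : Graph (Fin 2) (Sym2 (Fin 2)) := ofSimpleGraph (⊤ : SimpleGraph (Fin 2))

section Bundle

variable {α₁ β₁ α₂ β₂ α₃ β₃ : Type*}

/-- `IsBundleMap G B F pV pE`: the maps `pV` on vertices and `pE` on edges (an edge is mapped to an
edge, or collapsed to a vertex) exhibit `G` as a Cartesian graph bundle with fibre `F` over the base
graph `B`. -/
structure IsBundleMap (G : Graph α₁ β₁) (B : Graph α₂ β₂) (F : Graph α₃ β₃)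
    (pV : V(G) → V(B)) (pE : E(G) → V(B) ⊕ E(B)) : Prop where
  /-- Adjacent vertices are mapped to adjacent or identical vertices. -/
  adj_or_eq : ∀ x y : V(G), G.Adj x y → B.Adj (pV x) (pV y) ∨ pV x = pV y
  /-- The preimage of a vertex is a subgraph isomorphic to the fibre. -/
  fibre : ∀ v : V(B), ∃ H ≤ G,
    V(H) = (↑) '' (pV ⁻¹' {v}) ∧ E(H) = (↑) '' (pE ⁻¹' {Sum.inl v}) ∧
    Nonempty (Isom H F)
  /-- The preimage of an edge, together with the preimages of its two ends, is a subgraph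
  isomorphic to the Cartesian product of the complete graph of order two and the fibre. -/
  edge_fibre : ∀ (f : E(B)) (u v : V(B)), B.IsLink f u v → ∃ H ≤ G,
    V(H) = (↑) '' (pV ⁻¹' {u, v}) ∧
    E(H) = (↑) '' (pE ⁻¹' {Sum.inr f, Sum.inl u, Sum.inl v}) ∧
    Nonempty (Isom H (cartesianProduct completeTwo F))

/-- `G` is a Cartesian graph bundle with fibre `F` over the base graph `B`. -/
def IsCartesianBundle (G : Graph α₁ β₁) (B : Graph α₂ β₂) (F : Graph α₃ β₃) : Prop :=
  ∃ (pV : V(G) → V(B)) (pE : E(G) → V(B) ⊕ E(B)), IsBundleMap G B F pV pE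

end Bundle

/-- An orientation of a multigraph: one end of each edge is chosen as its tail, and the other end is
its head. -/
structure Orientation (G : Graph α β) where
  tail : E(G) → α
  head : E(G) → α
  isLink : ∀ e : E(G), G.IsLink e (tail e) (head e)

/-- The edges with tail at `v`. -/
def Orientation.outEdges {G : Graph α β} (D : G.Orientation) (v : α) : Set E(G) :=
  {e | D.tail e = v}

/-- The edges with head at `v`. -/
def Orientation.inEdges {G : Graph α β} (D : G.Orientation) (v : α) : Set E(G) :=
  {e | D.head e = v}

/-- `(D, φ)` is an `A`-flow: at every vertex the sum of `φ` over the outgoing edges equals the sum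
over the incoming edges (the sums are meant for a graph with finitely many edges). -/
def IsFlow {G : Graph α β} {A : Type*} [AddCommGroup A] (D : G.Orientation) (φ : E(G) → A) :
    Prop :=
  ∀ v ∈ V(G), ∑ᶠ e ∈ D.outEdges v, φ e = ∑ᶠ e ∈ D.inEdges v, φ e

/-- `G` admits a nowhere-zero `k`-flow: an integer flow with `0 < |φ e| < k` for every edge `e`. -/
def HasNowhereZeroFlow (G : Graph α β) (k : ℕ) : Prop :=
  ∃ (D : G.Orientation) (φ : E(G) → ℤ), IsFlow D φ ∧ ∀ e, φ e ≠ 0 ∧ |φ e| < k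

end Graph

/-! Every edge of the bundle lies in a copy of K₂ □ Θ, hence on a 4-cycle, and every finite graph
whose edges all lie on 4-cycles has a nowhere-zero 4-flow. For the second claim, start with the zero
flow in the Klein four-group and repair one zero edge at a time (`exists_flow_extend_of_square`).
Let `φ` vanish on `e₁` and let e₁e₂e₃e₄ be a square. Adding a constant c along the square works
unless c is a value of `φ` there, so it fails for all c only if `φ` takes all three nonzero values
on e₂, e₃, e₄. In that case put b = φ(e₃). The edges with values outside {0, b} form an even set
containing e₂ and e₄; without these two its odd vertices are the four corners, so it joins v₁ to
another corner. Adding b along this connection creates no zero, and closing it up through the square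
removes the zero at e₁, if need be after adding a constant on the square. Finally, each coordinate
of a Klein flow lifts to an integer flow with values 0, ±1 by an Eulerian orientation, and g₁ + 2g₂
is the required integer flow. -/

namespace Graph

/-! ### Chains modulo two and flows in the Klein four-group. -/

section Boundary

variable {V E M N : Type*} [Fintype E] [DecidableEq V]
  [AddCommGroup M] [Module (ZMod 2) M] [AddCommGroup N] [Module (ZMod 2) N]

/-- The boundary modulo two of an edge with the given ends. -/
def endsModTwo (s t : E → V) (e : E) : V → ZMod 2 := Pi.single (s e) 1 + Pi.single (t e) 1

/-- The boundary of a chain with coefficients in a vector space over the field of order two. -/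
def boundaryModTwo (s t : E → V) : (E → M) →ₗ[ZMod 2] (V → M) :=
  LinearMap.pi fun v ↦ ∑ e, endsModTwo s t e v • LinearMap.proj e

variable {s t : E → V}

lemma boundaryModTwo_apply (φ : E → M) (v : V) :
    boundaryModTwo s t φ v = ∑ e, endsModTwo s t e v • φ e := by
  simp [boundaryModTwo]

lemma boundaryModTwo_single [DecidableEq E] (e : E) :
    boundaryModTwo s t (Pi.single e (1 : ZMod 2)) = endsModTwo s t e := by
  ext v
  simp [boundaryModTwo_apply, Pi.single_apply]

lemma boundaryModTwo_comp (L : M →ₗ[ZMod 2] N) (φ : E → M) (hφ : boundaryModTwo s t φ = 0) :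
    boundaryModTwo s t (fun e ↦ L (φ e)) = 0 := by
  ext v
  have h := congrArg L (congrFun hφ v)
  simpa [boundaryModTwo_apply] using h

lemma boundaryModTwo_add_smul {φ : E → M} {p : E → ZMod 2} (hφ : boundaryModTwo s t φ = 0)
    (hp : boundaryModTwo s t p = 0) (b : M) :
    boundaryModTwo s t (fun e ↦ φ e + p e • b) = 0 := by
  have h : (fun e ↦ φ e + p e • b) = φ + fun e ↦ LinearMap.toSpanSingleton (ZMod 2) M b (p e) := by
    ext e; simp
  rw [h, map_add, hφ, boundaryModTwo_comp _ _ hp, add_zero]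

/-- If the boundary of a chain consists of four vertices, then a subchain joins the first of them
to one of the other three. -/
lemma exists_subchain_of_boundary_eq [Fintype V] (w : E → ZMod 2) (v₁ v₂ v₃ v₄ : V)
    (hw : boundaryModTwo s t w =
      Pi.single v₁ 1 + Pi.single v₂ 1 + Pi.single v₃ 1 + Pi.single v₄ 1) :
    ∃ p : E → ZMod 2, (∀ e, w e = 0 → p e = 0) ∧
      (boundaryModTwo s t p = Pi.single v₁ 1 + Pi.single v₂ 1 ∨
        boundaryModTwo s t p = Pi.single v₁ 1 + Pi.single v₃ 1 ∨
        boundaryModTwo s t p = Pi.single v₁ 1 + Pi.single v₄ 1) := by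
  classical
  -- `R` is the component of `v₁` in the support of `w`, described by subchains instead of paths.
  let R : V → Prop := fun x ↦ ∃ p : E → ZMod 2, (∀ e, w e = 0 → p e = 0) ∧
    boundaryModTwo s t p = Pi.single v₁ 1 + Pi.single x 1
  have hR₁ : R v₁ := ⟨0, by simp, by rw [map_zero, ZModModule.add_self]⟩
  have hstep : ∀ e x y, endsModTwo s t e = Pi.single x 1 + Pi.single y 1 → w e ≠ 0 → R x → R y := by
    rintro e x y he hwe ⟨p, hp, hbd⟩
    refine ⟨p + Pi.single e 1, fun e' he' ↦ ?_, ?_⟩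
    · have : e' ≠ e := by rintro rfl; exact hwe he'
      simp [hp e' he', this]
    · rw [map_add, hbd, boundaryModTwo_single, he, add_assoc, ← add_assoc (Pi.single x 1),
        ZModModule.add_self, zero_add]
  have hclosed : ∀ e, w e ≠ 0 → (R (s e) ↔ R (t e)) := fun e he ↦
    ⟨hstep e _ _ rfl he, hstep e _ _ (add_comm _ _) he⟩
  -- An edge of `w` has both ends in `R` or neither, so the boundary sums to zero over `R`. If `v₁`
  -- were the only one of the four vertices in `R`, the sum would be one.
  have hsum : ∑ v with R v, boundaryModTwo s t w v = 0 := by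
    simp_rw [boundaryModTwo_apply]
    rw [Finset.sum_comm]
    refine Finset.sum_eq_zero fun e _ ↦ ?_
    rw [← Finset.sum_smul]
    by_cases he : w e = 0
    · simp [he]
    · have : ∑ v with R v, endsModTwo s t e v = 0 := by
        by_cases h : R (t e) <;>
          simp [endsModTwo, Finset.sum_add_distrib, hclosed e he, h,
            CharTwo.add_self_eq_zero]
      simp [this]
  by_contra hcon
  have hR₂ : ¬ R v₂ := fun ⟨p, hp, h⟩ ↦ hcon ⟨p, hp, .inl h⟩
  have hR₃ : ¬ R v₃ := fun ⟨p, hp, h⟩ ↦ hcon ⟨p, hp, .inr (.inl h)⟩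
  have hR₄ : ¬ R v₄ := fun ⟨p, hp, h⟩ ↦ hcon ⟨p, hp, .inr (.inr h)⟩
  simp [hw, Finset.sum_add_distrib, hR₁, hR₂, hR₃, hR₄] at hsum

/-- The symplectic form on the Klein four-group. -/
def kleinForm (b : ZMod 2 × ZMod 2) : ZMod 2 × ZMod 2 →ₗ[ZMod 2] ZMod 2 :=
  b.1 • LinearMap.snd _ _ _ + b.2 • LinearMap.fst _ _ _

lemma kleinForm_apply (b x : ZMod 2 × ZMod 2) : kleinForm b x = b.1 * x.2 + b.2 * x.1 := rfl

/-- The form is alternating, so it vanishes at x = b, and x + b = 0 means x = b. -/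
lemma add_ne_zero_of_kleinForm_eq_one : ∀ b x : ZMod 2 × ZMod 2, kleinForm b x = 1 → x + b ≠ 0 := by
  simp only [kleinForm_apply]
  decide

/-- Either a constant can be added to four values, the first of which is zero, so as to make all of
them nonzero, or the other three values are the three nonzero elements of the Klein four-group. -/
lemma exists_shift_or_kleinForm_eq_one : ∀ x y z : ZMod 2 × ZMod 2,
    (∃ c, c ≠ 0 ∧ x + c ≠ 0 ∧ y + c ≠ 0 ∧ z + c ≠ 0) ∨
    (kleinForm y x = 1 ∧ kleinForm y z = 1 ∧ x ≠ 0 ∧ y ≠ 0 ∧ z ≠ 0 ∧ x + y ≠ 0 ∧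
      x + z ≠ 0 ∧ y + z ≠ 0) := by
  simp only [kleinForm_apply]
  decide

variable [DecidableEq E]

/-- A flow in the Klein four-group which vanishes on an edge of a closed trail of length four can be
changed so as not to vanish on this edge, without creating new zeros. -/
lemma exists_flow_extend_of_square [Fintype V] {φ : E → ZMod 2 × ZMod 2}
    (hφ : boundaryModTwo s t φ = 0)
    {e₁ e₂ e₃ e₄ : E} {v₁ v₂ v₃ v₄ : V} (he : [e₁, e₂, e₃, e₄].Nodup)
    (h₁ : endsModTwo s t e₁ = Pi.single v₁ 1 + Pi.single v₂ 1)
    (h₂ : endsModTwo s t e₂ = Pi.single v₂ 1 + Pi.single v₃ 1)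
    (h₃ : endsModTwo s t e₃ = Pi.single v₃ 1 + Pi.single v₄ 1)
    (h₄ : endsModTwo s t e₄ = Pi.single v₄ 1 + Pi.single v₁ 1) (hz : φ e₁ = 0) :
    ∃ φ' : E → ZMod 2 × ZMod 2, boundaryModTwo s t φ' = 0 ∧ φ' e₁ ≠ 0 ∧
      ∀ e, φ e ≠ 0 → φ' e ≠ 0 := by
  have cancel : ∀ x : V → ZMod 2, x + x = 0 := ZModModule.add_self
  simp only [List.nodup_cons, List.mem_cons, List.not_mem_nil, or_false, not_or,
    not_false_eq_true, List.nodup_nil, and_true] at he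
  obtain ⟨⟨h12, h13, h14⟩, ⟨h23, h24⟩, h34⟩ := he
  let C : E → ZMod 2 := Pi.single e₁ 1 + Pi.single e₂ 1 + Pi.single e₃ 1 + Pi.single e₄ 1
  have hC : boundaryModTwo s t C = 0 := by
    simp only [C, map_add, boundaryModTwo_single, h₁, h₂, h₃, h₄]
    linear_combination (exp := 1) cancel (Pi.single v₁ 1) + cancel (Pi.single v₂ 1) +
      cancel (Pi.single v₃ 1) + cancel (Pi.single v₄ 1)
  have hC₁ : C e₁ = 1 := by simp [C, *]
  have hC₂ : C e₂ = 1 := by simp [C, *, Ne.symm h12]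
  have hC₃ : C e₃ = 1 := by simp [C, *, Ne.symm h13, Ne.symm h23]
  have hC₄ : C e₄ = 1 := by simp [C, Ne.symm h14, Ne.symm h24, Ne.symm h34]
  have hC₀ : ∀ e, e ≠ e₁ → e ≠ e₂ → e ≠ e₃ → e ≠ e₄ → C e = 0 := by
    intro e h1 h2 h3 h4
    simp [C, h1, h2, h3, h4]
  have reduce : ∀ φ' : E → ZMod 2 × ZMod 2, boundaryModTwo s t φ' = 0 → φ' e₁ ≠ 0 → φ' e₂ ≠ 0 →
      φ' e₃ ≠ 0 → φ' e₄ ≠ 0 → (∀ e, e ≠ e₁ → e ≠ e₂ → e ≠ e₃ → e ≠ e₄ → φ e ≠ 0 → φ' e ≠ 0) →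
      ∃ φ' : E → ZMod 2 × ZMod 2, boundaryModTwo s t φ' = 0 ∧ φ' e₁ ≠ 0 ∧
        ∀ e, φ e ≠ 0 → φ' e ≠ 0 := by
    refine fun φ' h0 h1 h2 h3 h4 h ↦ ⟨φ', h0, h1, fun e he ↦ ?_⟩
    by_cases k1 : e = e₁
    · rwa [k1]
    by_cases k2 : e = e₂
    · rwa [k2]
    by_cases k3 : e = e₃
    · rwa [k3]
    by_cases k4 : e = e₄
    · rwa [k4]
    exact h e k1 k2 k3 k4 he
  obtain ⟨c, hc₁, hc₂, hc₃, hc₄⟩ | ⟨hf₂, hf₄, n₂, n₃, n₄, n₂₃, n₂₄, n₃₄⟩ :=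
    exists_shift_or_kleinForm_eq_one (φ e₂) (φ e₃) (φ e₄)
  · refine reduce (fun e ↦ φ e + C e • c) (boundaryModTwo_add_smul hφ hC c) ?_ ?_ ?_ ?_ ?_
    · simpa [hC₁, hz] using hc₁
    · simpa [hC₂] using hc₂
    · simpa [hC₃] using hc₃
    · simpa [hC₄] using hc₄
    · intro e k1 k2 k3 k4 h
      simpa [hC₀ e k1 k2 k3 k4] using h
  set b := φ e₃ with hb
  have hfb : kleinForm b b = 0 := by
    rw [kleinForm_apply, mul_comm, CharTwo.add_self_eq_zero]
  -- The form turns `φ` into a cycle modulo two through `e₂` and `e₄` but not `e₁` or `e₃`. Removing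
  -- `e₂` and `e₄` leaves a chain disjoint from the square, bounded by its four corners.
  let w : E → ZMod 2 := (fun e ↦ kleinForm b (φ e)) + Pi.single e₂ 1 + Pi.single e₄ 1
  have hw : boundaryModTwo s t w =
      Pi.single v₁ 1 + Pi.single v₂ 1 + Pi.single v₃ 1 + Pi.single v₄ 1 := by
    simp only [w, map_add, boundaryModTwo_single, h₂, h₄, boundaryModTwo_comp _ _ hφ]
    abel
  have hw₁ : w e₁ = 0 := by simp [w, hz, h12, h14]
  have hw₂ : w e₂ = 0 := by simp [w, hf₂, h24, CharTwo.add_self_eq_zero]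
  have hw₃ : w e₃ = 0 := by simp [w, ← hb, hfb, h34, Ne.symm h23]
  have hw₄ : w e₄ = 0 := by simp [w, hf₄, Ne.symm h24, CharTwo.add_self_eq_zero]
  obtain ⟨p, hp, hbd⟩ := exists_subchain_of_boundary_eq w v₁ v₂ v₃ v₄ hw
  have hp₁ := hp _ hw₁
  have hp₂ := hp _ hw₂
  have hp₃ := hp _ hw₃
  have hp₄ := hp _ hw₄
  have hout : ∀ e, e ≠ e₁ → e ≠ e₂ → e ≠ e₃ → e ≠ e₄ → φ e ≠ 0 → φ e + p e • b ≠ 0 := by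
    intro e k1 k2 k3 k4 h
    by_cases hpe : p e = 0
    · simpa [hpe] using h
    have hpe1 : p e = 1 := by generalize p e = x at hpe; revert x; decide
    have hwe : w e ≠ 0 := fun h ↦ hpe (hp e h)
    have hwe' : kleinForm b (φ e) = 1 := by
      simp only [w, Pi.add_apply, Pi.single_apply, k2, k4, if_false, add_zero] at hwe
      generalize kleinForm b (φ e) = x at hwe; revert x; decide
    rw [hpe1, one_smul]
    exact add_ne_zero_of_kleinForm_eq_one _ _ hwe'
  obtain hbd | hbd | hbd := hbd
  -- From `v₁` to `v₂`: close up through `e₁`, which gets the value `b`.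
  · have hq : boundaryModTwo s t (p + Pi.single e₁ 1) = 0 := by
      rw [map_add, hbd, boundaryModTwo_single, h₁, cancel]
    refine reduce _ (boundaryModTwo_add_smul hφ hq b) ?_ ?_ ?_ ?_ ?_
    · simpa [hp₁, hz] using n₃
    · simpa [hp₂, Ne.symm h12] using n₂
    · simpa [hp₃, Ne.symm h13] using n₃
    · simpa [hp₄, Ne.symm h14] using n₄
    · intro e k1 k2 k3 k4 h
      simpa [k1] using hout e k1 k2 k3 k4 h
  -- From `v₁` to `v₃`: close up through `e₁` and `e₂`; the latter stays nonzero because `φ e₂ ≠ b`.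
  · have hq : boundaryModTwo s t (p + (Pi.single e₁ 1 + Pi.single e₂ 1)) = 0 := by
      rw [map_add, map_add, hbd, boundaryModTwo_single, boundaryModTwo_single, h₁, h₂]
      linear_combination (exp := 1) cancel (Pi.single v₁ 1) + cancel (Pi.single v₂ 1) +
        cancel (Pi.single v₃ 1)
    refine reduce _ (boundaryModTwo_add_smul hφ hq b) ?_ ?_ ?_ ?_ ?_
    · simpa [hp₁, hz, h12] using n₃
    · simpa [hp₂, Ne.symm h12] using n₂₃
    · simpa [hp₃, Ne.symm h13, Ne.symm h23] using n₃
    · simpa [hp₄, Ne.symm h14, Ne.symm h24] using n₄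
    · intro e k1 k2 k3 k4 h
      simpa [k1, k2] using hout e k1 k2 k3 k4 h
  -- From `v₁` to `v₄`: closing up through `e₄` leaves `e₁` at zero but changes `e₄` to `φ e₄ + b =
  -- φ e₂`. The value `φ e₄` is then absent from the square and can be added all around it.
  · have hq : boundaryModTwo s t (p + Pi.single e₄ 1) = 0 := by
      rw [map_add, hbd, boundaryModTwo_single, h₄, add_comm (Pi.single v₄ 1), cancel]
    have hself : φ e₄ + b + φ e₄ = b := by
      rw [add_right_comm, ZModModule.add_self, zero_add]
    refine reduce _ (boundaryModTwo_add_smul (boundaryModTwo_add_smul hφ hq b) hC (φ e₄))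
      ?_ ?_ ?_ ?_ ?_
    · simpa [hp₁, hz, h14, hC₁] using n₄
    · simpa [hp₂, h24, hC₂] using n₂₄
    · simpa [hp₃, h34, hC₃, ← hb] using n₃₄
    · simpa [hp₄, hC₄, hself] using n₃
    · intro e k1 k2 k3 k4 h
      simpa [k4, hC₀ e k1 k2 k3 k4] using hout e k1 k2 k3 k4 h

/-- If every edge lies on a closed trail of length four, then there is a nowhere-zero flow in the
Klein four-group. -/
theorem exists_nowhereZero_kleinFlow_of_squares [Fintype V]
    (h : ∀ e₁ : E, ∃ (e₂ e₃ e₄ : E) (v₁ v₂ v₃ v₄ : V), [e₁, e₂, e₃, e₄].Nodup ∧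
      endsModTwo s t e₁ = Pi.single v₁ 1 + Pi.single v₂ 1 ∧
      endsModTwo s t e₂ = Pi.single v₂ 1 + Pi.single v₃ 1 ∧
      endsModTwo s t e₃ = Pi.single v₃ 1 + Pi.single v₄ 1 ∧
      endsModTwo s t e₄ = Pi.single v₄ 1 + Pi.single v₁ 1) :
    ∃ φ : E → ZMod 2 × ZMod 2, boundaryModTwo s t φ = 0 ∧ ∀ e, φ e ≠ 0 := by
  -- Since a repair creates no new zeros, the edges can be treated one at a time.
  suffices ∀ T : Finset E, ∃ φ : E → ZMod 2 × ZMod 2,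
      boundaryModTwo s t φ = 0 ∧ ∀ e ∈ T, φ e ≠ 0 by
    simpa using this Finset.univ
  intro T
  induction T using Finset.induction_on with
  | empty => exact ⟨0, map_zero _, by simp⟩
  | insert e T _ ih =>
    obtain ⟨φ, hφ, hT⟩ := ih
    by_cases hz : φ e = 0
    · obtain ⟨e₂, e₃, e₄, v₁, v₂, v₃, v₄, he, h₁, h₂, h₃, h₄⟩ := h e
      obtain ⟨φ', hφ', he', hsupp⟩ := exists_flow_extend_of_square hφ he h₁ h₂ h₃ h₄ hz
      refine ⟨φ', hφ', fun a ha ↦ ?_⟩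
      obtain rfl | ha := Finset.mem_insert.1 ha
      · exact he'
      · exact hsupp a (hT a ha)
    · refine ⟨φ, hφ, fun a ha ↦ ?_⟩
      obtain rfl | ha := Finset.mem_insert.1 ha
      · exact hz
      · exact hT a ha

end Boundary

/-! ### From Klein flows to integer flows. -/

section IntegerFlow

variable {V E : Type*} [DecidableEq V] [DecidableEq E]

/-- An even set of edges has an Eulerian orientation. -/
theorem exists_sign_of_even (S : Finset E) : ∀ s t : E → V, ∑ e ∈ S, endsModTwo s t e = 0 →
    ∃ σ : E → ℤ, (∀ e, |σ e| = 1) ∧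
      ∑ e ∈ S, σ e • (Pi.single (s e) 1 - Pi.single (t e) 1 : V → ℤ) = 0 := by
  -- The end maps remain quantified, because the induction step reattaches an edge.
  induction S using Finset.induction_on with
  | empty => exact fun _ _ _ ↦ ⟨1, by simp, by simp⟩
  | insert e S he ih =>
    intro s t h
    rw [Finset.sum_insert he] at h
    have extend : ∀ (c : ℤ) (σ : E → ℤ), |c| = 1 → (∀ e, |σ e| = 1) →
        c • (Pi.single (s e) 1 - Pi.single (t e) 1 : V → ℤ) +
          ∑ e ∈ S, σ e • (Pi.single (s e) 1 - Pi.single (t e) 1 : V → ℤ) = 0 →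
        ∃ σ : E → ℤ, (∀ e, |σ e| = 1) ∧
          ∑ e ∈ insert e S, σ e • (Pi.single (s e) 1 - Pi.single (t e) 1 : V → ℤ) = 0 := by
      intro c σ hc hσ hsum
      refine ⟨Function.update σ e c, fun a ↦ ?_, ?_⟩
      · obtain rfl | ha := eq_or_ne a e <;> simp [*]
      · rw [Finset.sum_insert he, Function.update_self, ← hsum]
        congr 1
        refine Finset.sum_congr rfl fun a ha ↦ ?_
        rw [Function.update_of_ne (ne_of_mem_of_not_mem ha he)]
    by_cases hloop : s e = t e
    · obtain ⟨σ, hσ, hsum⟩ := ih s t <| by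
        simpa [endsModTwo, hloop, ZModModule.add_self] using h
      exact extend 1 σ (by simp) hσ (by rw [hsum, hloop, sub_self, smul_zero, add_zero])
    -- The non-loop `e` counts once at `t e`, so by parity another edge `f` has an end there. Splice
    -- `e` and `f` into one edge by moving that end of `f` to `s e`, and orient the result by
    -- induction.
    obtain ⟨f, hf, hft⟩ : ∃ f ∈ S, endsModTwo s t f (t e) ≠ 0 := by
      apply Finset.exists_ne_zero_of_sum_ne_zero
      intro h0
      have := congrFun h (t e)
      simp [endsModTwo, Pi.single_apply, Ne.symm hloop] at this h0
      simp [h0] at this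
    have hft' : s f = t e ∨ t f = t e := by
      by_contra! hne
      simp [endsModTwo, hne.1.symm, hne.2.symm] at hft
    rw [← Finset.add_sum_erase _ _ hf] at h
    obtain hs | ht := hft'
    · have hrest : ∀ a ∈ S.erase f, Function.update s f (s e) a = s a := fun a ha ↦
        Function.update_of_ne (Finset.ne_of_mem_erase ha) _ _
      obtain ⟨σ, hσ, hsum⟩ := ih (Function.update s f (s e)) t <| by
        rw [← Finset.add_sum_erase _ _ hf, ← h, ← add_assoc]
        congr 1
        · simp only [endsModTwo, Function.update_self, hs]
          rw [add_assoc, ← add_assoc (Pi.single (t e) 1), ZModModule.add_self, zero_add]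
        · exact Finset.sum_congr rfl fun a ha ↦ by simp only [endsModTwo, hrest a ha]
      -- The spliced edge runs along `e` and then `f`, so `e` takes the sign of `f`.
      refine extend (σ f) σ (hσ f) hσ ?_
      rw [← Finset.add_sum_erase _ _ hf] at hsum ⊢
      rw [Finset.sum_congr rfl fun a ha ↦ by rw [hrest a ha]] at hsum
      rw [← hsum, Function.update_self, hs]
      module
    · have hrest : ∀ a ∈ S.erase f, Function.update t f (s e) a = t a := fun a ha ↦
        Function.update_of_ne (Finset.ne_of_mem_erase ha) _ _
      obtain ⟨σ, hσ, hsum⟩ := ih s (Function.update t f (s e)) <| by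
        rw [← Finset.add_sum_erase _ _ hf, ← h, ← add_assoc]
        congr 1
        · simp only [endsModTwo, Function.update_self, ht]
          rw [add_add_add_comm, add_comm (Pi.single (t e) 1), add_assoc, add_comm,
            ← add_assoc, add_assoc, ZModModule.add_self, add_zero]
        · exact Finset.sum_congr rfl fun a ha ↦ by simp only [endsModTwo, hrest a ha]
      -- Here the spliced edge runs along `f` and then backwards along `e`, hence the opposite sign.
      refine extend (-σ f) σ (by rw [abs_neg, hσ f]) hσ ?_
      rw [← Finset.add_sum_erase _ _ hf] at hsum ⊢
      rw [Finset.sum_congr rfl fun a ha ↦ by rw [hrest a ha]] at hsum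
      rw [← hsum, Function.update_self, ht]
      module

/-- A flow modulo two lifts to an integer flow with values `0`, `1` and `-1`. -/
theorem exists_integer_lift [Fintype E] {s t : E → V} {f : E → ZMod 2}
    (hf : boundaryModTwo s t f = 0) :
    ∃ g : E → ℤ, (∀ e, f e = 0 → g e = 0) ∧ (∀ e, f e ≠ 0 → |g e| = 1) ∧
      ∑ e, g e • (Pi.single (s e) 1 - Pi.single (t e) 1 : V → ℤ) = 0 := by
  obtain ⟨σ, hσ, hsum⟩ := exists_sign_of_even {e | f e ≠ 0} s t <| by
    rw [Finset.sum_filter]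
    refine Eq.trans ?_ hf
    ext v
    rw [boundaryModTwo_apply, Finset.sum_apply]
    refine Finset.sum_congr rfl fun e _ ↦ ?_
    have key : ∀ x : ZMod 2, x ≠ 0 → x = 1 := by decide
    by_cases he : f e = 0
    · simp [he]
    · simp [key _ he]
  refine ⟨fun e ↦ if f e = 0 then 0 else σ e, fun e he ↦ by simp [he],
    fun e he ↦ by simp [he, hσ], ?_⟩
  rw [Finset.sum_filter] at hsum
  rw [← hsum]
  refine Finset.sum_congr rfl fun e _ ↦ ?_
  by_cases he : f e = 0 <;> simp [he]

/-- A nowhere-zero flow in the Klein four-group yields a nowhere-zero integer flow with values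
between `-3` and `3`. -/
theorem exists_nowhereZero_integer_flow [Fintype E] {s t : E → V} {φ : E → ZMod 2 × ZMod 2}
    (hφ : boundaryModTwo s t φ = 0) (h0 : ∀ e, φ e ≠ 0) :
    ∃ g : E → ℤ, (∀ e, g e ≠ 0 ∧ |g e| < 4) ∧
      ∑ e, g e • (Pi.single (s e) 1 - Pi.single (t e) 1 : V → ℤ) = 0 := by
  obtain ⟨g₁, hz₁, hn₁, hs₁⟩ := exists_integer_lift
    (boundaryModTwo_comp (LinearMap.fst (ZMod 2) (ZMod 2) (ZMod 2)) φ hφ)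
  obtain ⟨g₂, hz₂, hn₂, hs₂⟩ := exists_integer_lift
    (boundaryModTwo_comp (LinearMap.snd (ZMod 2) (ZMod 2) (ZMod 2)) φ hφ)
  -- With both values in {0, 1, -1}, this sum has absolute value at most 3 and vanishes only if both
  -- do, which `h0` excludes.
  refine ⟨fun e ↦ g₁ e + 2 * g₂ e, fun e ↦ ?_, ?_⟩
  · have h₁ : g₁ e = 0 ∨ g₁ e = 1 ∨ g₁ e = -1 := by
      by_cases h : (φ e).1 = 0
      · exact .inl (hz₁ e h)
      · exact .inr (eq_or_eq_neg_of_abs_eq (hn₁ e h))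
    have h₂ : g₂ e = 0 ∨ g₂ e = 1 ∨ g₂ e = -1 := by
      by_cases h : (φ e).2 = 0
      · exact .inl (hz₂ e h)
      · exact .inr (eq_or_eq_neg_of_abs_eq (hn₂ e h))
    have h₁₂ : g₁ e ≠ 0 ∨ g₂ e ≠ 0 := by
      by_contra! hcon
      refine h0 e (Prod.ext ?_ ?_)
      · by_contra h
        simpa [hcon.1] using hn₁ e h
      · by_contra h
        simpa [hcon.2] using hn₂ e h
    dsimp only
    rw [abs_lt]
    omega
  · simp only [add_smul, mul_smul, Finset.sum_add_distrib, ← Finset.smul_sum, hs₁, hs₂, smul_zero,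
      add_zero]

end IntegerFlow

/-! ### Squares in Cartesian products and in bundles. -/

variable {α β γ δ : Type*}

/-- The edge `e` lies on a cycle of length four. -/
def OnSquare (G : Graph α β) (e : β) : Prop :=
  ∃ (e₂ e₃ e₄ : β) (v₁ v₂ v₃ v₄ : α), [e, e₂, e₃, e₄].Nodup ∧
    G.IsLink e v₁ v₂ ∧ G.IsLink e₂ v₂ v₃ ∧ G.IsLink e₃ v₃ v₄ ∧ G.IsLink e₄ v₄ v₁

lemma OnSquare.mono {G H : Graph α β} (hHG : H ≤ G) {e : β} (h : H.OnSquare e) : G.OnSquare e := by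
  obtain ⟨e₂, e₃, e₄, v₁, v₂, v₃, v₄, he, h₁, h₂, h₃, h₄⟩ := h
  exact ⟨e₂, e₃, e₄, v₁, v₂, v₃, v₄, he, h₁.mono hHG, h₂.mono hHG, h₃.mono hHG, h₄.mono hHG⟩

lemma Isom.isLink_symm {G : Graph α β} {H : Graph γ δ} (i : Isom G H) {e : δ} {x y : γ}
    (h : H.IsLink e x y) : G.IsLink (i.edgeEquiv.symm ⟨e, h.edge_mem⟩)
      (i.vertexEquiv.symm ⟨x, h.left_mem⟩) (i.vertexEquiv.symm ⟨y, h.right_mem⟩) := by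
  rw [← i.isLink_iff]
  simpa using h

lemma Isom.onSquare {G : Graph α β} {H : Graph γ δ} (i : Isom G H) (e : E(G))
    (h : H.OnSquare (i.edgeEquiv e)) : G.OnSquare e := by
  obtain ⟨e₂, e₃, e₄, v₁, v₂, v₃, v₄, he, h₁, h₂, h₃, h₄⟩ := h
  refine ⟨_, _, _, _, _, _, _, ?_, by simpa using i.isLink_symm h₁, i.isLink_symm h₂,
    i.isLink_symm h₃, i.isLink_symm h₄⟩
  have hnodup : ([i.edgeEquiv e, ⟨e₂, h₂.edge_mem⟩, ⟨e₃, h₃.edge_mem⟩, ⟨e₄, h₄.edge_mem⟩] :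
      List E(H)).Nodup := List.Nodup.of_map Subtype.val he
  simpa using hnodup.map (Subtype.val_injective.comp i.edgeEquiv.symm.injective)

lemma cartesianProduct_isLink_inl {G : Graph α β} {H : Graph γ δ} {u : α} {e : δ} {x y : γ}
    (hu : u ∈ V(G)) (h : H.IsLink e x y) :
    (cartesianProduct G H).IsLink (.inl (u, e)) (u, x) (u, y) := ⟨hu, rfl, rfl, h⟩

lemma cartesianProduct_isLink_inr {G : Graph α β} {H : Graph γ δ} {u : γ} {e : β} {x y : α}
    (hu : u ∈ V(H)) (h : G.IsLink e x y) :
    (cartesianProduct G H).IsLink (.inr (e, u)) (x, u) (y, u) := ⟨hu, rfl, rfl, h⟩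

/-- In a Cartesian product of loopless graphs without isolated vertices every edge lies on a
square. -/
theorem onSquare_cartesianProduct {G : Graph α β} {H : Graph γ δ} (hG : G.Loopless)
    (hH : H.Loopless) (hG' : G.NoIsolatedVertex) (hH' : H.NoIsolatedVertex)
    {a : (α × δ) ⊕ (β × γ)} (ha : a ∈ E(cartesianProduct G H)) :
    (cartesianProduct G H).OnSquare a := by
  obtain ⟨⟨x₁, x₂⟩, ⟨y₁, y₂⟩, h⟩ := exists_isLink_of_mem_edgeSet ha
  match a with
  | .inl (u, e) =>
    obtain ⟨hu, -, -, h : H.IsLink e x₂ y₂⟩ := h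
    obtain ⟨f, v, hf⟩ := hG' u hu
    have huv : u ≠ v := by rintro rfl; exact hG.not_isLoopAt f u hf
    have hxy : x₂ ≠ y₂ := by rintro rfl; exact hH.not_isLoopAt e x₂ h
    -- The square is the product of the edges `e` and `f`. Looplessness makes the two copies of each
    -- of them distinct.
    exact ⟨_, _, _, _, _, _, _, by simp [huv, hxy.symm], cartesianProduct_isLink_inl hu h,
      cartesianProduct_isLink_inr h.right_mem hf, cartesianProduct_isLink_inl hf.right_mem h.symm,
      cartesianProduct_isLink_inr h.left_mem hf.symm⟩
  | .inr (f, u) =>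
    obtain ⟨hu, -, -, h : G.IsLink f x₁ y₁⟩ := h
    obtain ⟨e, v, he⟩ := hH' u hu
    have huv : u ≠ v := by rintro rfl; exact hH.not_isLoopAt e u he
    have hxy : x₁ ≠ y₁ := by rintro rfl; exact hG.not_isLoopAt f x₁ h
    exact ⟨_, _, _, _, _, _, _, by simp [huv, hxy.symm], cartesianProduct_isLink_inr hu h,
      cartesianProduct_isLink_inl h.right_mem he, cartesianProduct_isLink_inr he.right_mem h.symm,
      cartesianProduct_isLink_inl h.left_mem he.symm⟩

lemma loopless_completeTwo : completeTwo.Loopless where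
  not_isLoopAt e x h := by
    have : completeTwo.Adj x x := ⟨e, h⟩
    simp [completeTwo] at this

lemma noIsolatedVertex_completeTwo : completeTwo.NoIsolatedVertex := by
  intro x _
  have : completeTwo.Adj x (x + 1) := by simp [completeTwo]
  obtain ⟨e, he⟩ := this
  exact ⟨e, he.inc_left⟩

/-- Every edge of a Cartesian graph bundle lies on a square. -/
theorem IsCartesianBundle.onSquare {α₁ β₁ α₂ β₂ α₃ β₃ : Type*} {G : Graph α₁ β₁} {B : Graph α₂ β₂}
    {F : Graph α₃ β₃} (h : G.IsCartesianBundle B F) (hF : F.Loopless)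
    (hB' : B.NoIsolatedVertex) (hF' : F.NoIsolatedVertex) {e : β₁} (he : e ∈ E(G)) :
    G.OnSquare e := by
  obtain ⟨pV, pE, hp⟩ := h
  -- An edge collapsed to a vertex `u` lies over every base edge at `u`, and one exists since `u` is
  -- not isolated. So a single use of `edge_fibre` covers both kinds of edges.
  obtain ⟨f, u, v, huv, hmem⟩ : ∃ (f : E(B)) (u v : V(B)), B.IsLink f u v ∧
      pE ⟨e, he⟩ ∈ ({Sum.inr f, Sum.inl u, Sum.inl v} : Set (V(B) ⊕ E(B))) := by
    match hpe : pE ⟨e, he⟩ with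
    | .inl u =>
      obtain ⟨f, v, hf⟩ := hB' u u.2
      exact ⟨⟨f, hf.edge_mem⟩, u, ⟨v, hf.right_mem⟩, hf, by simp⟩
    | .inr f =>
      obtain ⟨u, v, hf⟩ := exists_isLink_of_mem_edgeSet f.2
      exact ⟨f, ⟨u, hf.left_mem⟩, ⟨v, hf.right_mem⟩, hf, by simp⟩
  obtain ⟨H, hHG, -, hE, ⟨i⟩⟩ := hp.edge_fibre f u v huv
  have heH : e ∈ E(H) := hE ▸ ⟨⟨e, he⟩, hmem, rfl⟩
  exact (i.onSquare ⟨e, heH⟩ (onSquare_cartesianProduct loopless_completeTwo hF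
    noIsolatedVertex_completeTwo hF' (i.edgeEquiv _).2)).mono hHG

/-- A finite graph all of whose edges lie on squares has a nowhere-zero 4-flow. -/
theorem hasNowhereZeroFlow_four_of_onSquare {G : Graph α β} (hV : V(G).Finite) (hE : E(G).Finite)
    (h : ∀ e ∈ E(G), G.OnSquare e) : G.HasNowhereZeroFlow 4 := by
  classical
  have := hV.fintype
  have := hE.fintype
  choose s t hst using fun e : E(G) ↦ exists_isLink_of_mem_edgeSet e.2
  let s' : E(G) → V(G) := fun e ↦ ⟨s e, (hst e).left_mem⟩
  let t' : E(G) → V(G) := fun e ↦ ⟨t e, (hst e).right_mem⟩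
  have hends : ∀ (e : E(G)) (x y : V(G)), G.IsLink e x y →
      endsModTwo s' t' e = Pi.single x 1 + Pi.single y 1 := by
    intro e x y hxy
    obtain ⟨h₁, h₂⟩ | ⟨h₁, h₂⟩ := (hst e).eq_and_eq_or_eq_and_eq hxy
    · have hx : s' e = x := Subtype.ext h₁
      have hy : t' e = y := Subtype.ext h₂
      rw [endsModTwo, hx, hy]
    · have hx : s' e = y := Subtype.ext h₁
      have hy : t' e = x := Subtype.ext h₂
      rw [endsModTwo, hx, hy, add_comm]
  obtain ⟨φ, hφ, hφ0⟩ := exists_nowhereZero_kleinFlow_of_squares (s := s') (t := t') <| by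
    intro e
    obtain ⟨e₂, e₃, e₄, v₁, v₂, v₃, v₄, he, h₁, h₂, h₃, h₄⟩ := h e e.2
    exact ⟨⟨e₂, h₂.edge_mem⟩, ⟨e₃, h₃.edge_mem⟩, ⟨e₄, h₄.edge_mem⟩, ⟨v₁, h₁.left_mem⟩,
      ⟨v₂, h₂.left_mem⟩, ⟨v₃, h₃.left_mem⟩, ⟨v₄, h₄.left_mem⟩, List.Nodup.of_map Subtype.val he,
      hends _ _ _ h₁, hends _ _ _ h₂, hends _ _ _ h₃, hends _ _ _ h₄⟩
  obtain ⟨g, hg, hsum⟩ := exists_nowhereZero_integer_flow hφ hφ0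
  refine ⟨⟨s, t, hst⟩, g, fun v hv ↦ ?_, hg⟩
  -- The coordinate at `v` of the vanishing integer boundary is outflow minus inflow.
  have hsum' := congrFun hsum ⟨v, hv⟩
  simp only [Finset.sum_apply, Pi.smul_apply, Pi.sub_apply, Pi.single_apply, smul_eq_mul, mul_sub,
    Finset.sum_sub_distrib, Pi.zero_apply, mul_ite, mul_one, mul_zero, sub_eq_zero] at hsum'
  have hfin : ∀ r : E(G) → α, ∑ᶠ e ∈ {e | r e = v}, g e = ∑ e, if v = r e then g e else 0 := by
    intro r
    rw [finsum_mem_eq_finite_toFinset_sum _ (Set.toFinite _), ← Finset.sum_filter]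
    refine Finset.sum_congr ?_ fun _ _ ↦ rfl
    ext e
    simp [eq_comm]
  rw [Orientation.outEdges, Orientation.inEdges, hfin, hfin]
  simpa [s', t', Subtype.ext_iff] using hsum'

end Graph

theorem theorem4p5 {α₁ β₁ α₂ β₂ α₃ β₃ : Type*}
    (G : Graph α₁ β₁) (B : Graph α₂ β₂) (F : Graph α₃ β₃)
    (hG : G.IsFiniteLoopless) (hB : B.IsFiniteLoopless) (hF : F.IsFiniteLoopless)
    (hB' : B.NoIsolatedVertex) (hF' : F.NoIsolatedVertex)
    (hbundle : G.IsCartesianBundle B F) :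
    G.HasNowhereZeroFlow 4 :=
  Graph.hasNowhereZeroFlow_four_of_onSquare hG.finite_vertexSet hG.finite_edgeSet
    fun _ he ↦ hbundle.onSquare hF.loopless hB' hF' he
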